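/- Let $q$ be a complex number with $|q|<1$ and let $m\ge 0$ be an integer; if $m\ge 2$, assume $q\neq 0$. Write $(a;q)_n=\prod_{i=0}^{n-1}(1-aq^i)$, $(a;q)_\infty=\prod_{i=0}^{\infty}(1-aq^i)$, $(a_1,a_2,a_3;q)_\infty=(a_1;q)_\infty(a_2;q)_\infty(a_3;q)_\infty$, and, for integers $N,M$, $$\left[{N\atop M}\right]=\frac{(q;q)_N}{(q;q)_M(q;q)_{N-M}}\ \text{ if } 0\le M\le N,\qquad \left[{N\atop M}\right]=0\ \text{ otherwise}.$$ Let $a_0(q)=1$, $b_0(q)=0$, and for $m\ge 1$ $$a_m(q)=\sum_{n} q^{n^2+n}\left[{m-2-n\atop n}\right],\qquad b_m(q)=\sum_{n} q^{n^2}\left[{m-1-n\atop n}\right],$$ the sums being over all integers $n$ (only finitely many terms are nonzero). Then the following series converges absolutely and $$\sum_{n=0}^{\infty}\frac{(1-q^{2n+m})(q;q)_{n+m-1}\,q^{n(5n-1)/2+2mn}(-1)^n}{(q;q)_n}=\frac{b_m(q)\,(q,q^4,q^5;q^5)_\infty-a_m(q)\,(q^2,q^3,q^5;q^5)_\infty}{(-1)^{m-1}q^{m(m-1)/2}},$$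 where for $n=m=0$ the product $(1-q^{2n+m})(q;q)_{n+m-1}$ is read as $1$ (that is, $(1-q^m)(q;q)_{m-1}=(q;q)_m$ also for $m=0$), and $q^0=1$ also for $q=0$. -/

import Mathlib

namespace MVersion

/-- The finite `q`-shifted factorial `(a; q)_n = ∏_{i < n} (1 - a q^i)`. -/
noncomputable def qPoch (a q : ℂ) (n : ℕ) : ℂ :=
  ∏ i ∈ Finset.range n, (1 - a * q ^ i)

/-- The infinite product `(a; q)_∞ = ∏_{i ≥ 0} (1 - a q^i)`
(it converges whenever `‖q‖ < 1`, see `multipliable_qPochInf`). -/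
noncomputable def qPochInf (a q : ℂ) : ℂ :=
  ∏' i : ℕ, (1 - a * q ^ i)

theorem multipliable_qPochInf (a : ℂ) {q : ℂ} (hq : ‖q‖ < 1) :
    Multipliable fun i : ℕ => 1 - a * q ^ i := by
  have h : Summable fun i : ℕ => ‖-(a * q ^ i)‖ := by
    simpa [norm_mul, norm_pow] using
      (summable_geometric_of_lt_one (norm_nonneg q) hq).mul_left ‖a‖
  simpa [sub_eq_add_neg] using multipliable_one_add_of_summable h

/-- The Gaussian polynomial `[N; M]_q` for integers `N`, `M`: it is
`(q; q)_N / ((q; q)_M (q; q)_{N - M})` if `0 ≤ M ≤ N`, and `0` otherwise. -/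
noncomputable def gauss (q : ℂ) (N M : ℤ) : ℂ :=
  if 0 ≤ M ∧ M ≤ N then
    qPoch q q N.toNat / (qPoch q q M.toNat * qPoch q q (N - M).toNat)
  else 0

/-- `a_0(q) = 1`, and `a_m(q) = ∑_n q^{n^2+n} [m-2-n; n]_q` for `m ≥ 1`. The sum is over all `n`;
the Gaussian polynomial vanishes unless `0 ≤ n ≤ m - 2 - n`, which forces `0 ≤ n < m`. -/
noncomputable def a (m : ℕ) (q : ℂ) : ℂ :=
  if m = 0 then 1
  else ∑ n ∈ Finset.range m, q ^ (n ^ 2 + n) * gauss q ((m : ℤ) - 2 - n) n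

/-- `b_0(q) = 0`, and `b_m(q) = ∑_n q^{n^2} [m-1-n; n]_q` for `m ≥ 1`. The sum is over all `n`;
the Gaussian polynomial vanishes unless `0 ≤ n ≤ m - 1 - n`, which forces `0 ≤ n < m`. -/
noncomputable def b (m : ℕ) (q : ℂ) : ℂ :=
  if m = 0 then 0
  else ∑ n ∈ Finset.range m, q ^ (n ^ 2) * gauss q ((m : ℤ) - 1 - n) n

/-- The factor `(1 - q^{2n+m}) (q; q)_{n+m-1}`. For `n = m = 0` the formal expression
`(1 - q^0) (q; q)_{-1}`, with `(q; q)_{-1} = 1 / (1 - q^0)`, is read as `1`, which is the value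
of `(1 - q^m) (q; q)_{m-1} = (q; q)_m` at `m = 0`. -/
noncomputable def wpFactor (m n : ℕ) (q : ℂ) : ℂ :=
  if n + m = 0 then 1 else (1 - q ^ (2 * n + m)) * qPoch q q (n + m - 1)

end MVersion

namespace MVersion

open Filter Topology Finset

/-! ### Shifted factorials: non-vanishing, limits and uniform bounds. -/

section Pochhammer

/-! Let `S_m` be the sum of the series. Termwise, `S_m - S_{m+1} - q^{m+1} S_{m+2}` telescopes with
partial sums tending to `0` (`hasSum_seriesTerm_recurrence`), so `R_m = (-1)^{m-1} q^{m(m-1)/2} S_m`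
satisfies `R_{m+2} = R_{m+1} + q^m R_m`. By the q-Pascal rule `a_m` and `b_m` obey the same
recurrence (`schur_add_two`), with initial values `1, 0` and `0, 1`; hence `R_m = b_m S_1 - a_m
S_0`. Finally `S_0` and `S_1` are folded theta series, evaluated by the Jacobi triple product
(`hasSum_thetaTerm`) in base `q^5`. -/

theorem qPoch_zero (a q : ℂ) : qPoch a q 0 = 1 := by simp [qPoch]

theorem qPoch_succ (a q : ℂ) (n : ℕ) : qPoch a q (n + 1) = qPoch a q n * (1 - a * q ^ n) :=
  Finset.prod_range_succ _ _

theorem one_sub_pow_succ_ne_zero {q : ℂ} (hq : ‖q‖ < 1) (n : ℕ) : 1 - q * q ^ n ≠ 0 := by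
  rw [← pow_succ', sub_ne_zero]
  intro h
  have : ‖q ^ (n + 1)‖ < 1 := by
    rw [norm_pow]
    exact pow_lt_one₀ (norm_nonneg q) hq n.succ_ne_zero
  simp [← h] at this

theorem qPoch_self_ne_zero {q : ℂ} (hq : ‖q‖ < 1) (n : ℕ) : qPoch q q n ≠ 0 :=
  Finset.prod_ne_zero_iff.2 fun i _ => one_sub_pow_succ_ne_zero hq i

theorem tendsto_qPoch (a : ℂ) {q : ℂ} (hq : ‖q‖ < 1) :
    Tendsto (qPoch a q) atTop (𝓝 (qPochInf a q)) :=
  (multipliable_qPochInf a hq).tendsto_prod_tprod_nat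

theorem qPochInf_self_ne_zero {q : ℂ} (hq : ‖q‖ < 1) : qPochInf q q ≠ 0 := by
  have h : Summable fun i : ℕ => ‖-(q * q ^ i)‖ := by
    simpa [norm_mul, norm_pow] using
      (summable_geometric_of_lt_one (norm_nonneg q) hq).mul_left ‖q‖
  have := tprod_one_add_ne_zero_of_summable
    (fun i => by simpa [sub_eq_add_neg] using one_sub_pow_succ_ne_zero hq i) h
  simpa [qPochInf, sub_eq_add_neg] using this

theorem exists_norm_qPoch_self_le {q : ℂ} (hq : ‖q‖ < 1) :
    ∃ C, ∀ n, ‖qPoch q q n‖ ≤ C := by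
  obtain ⟨C, hC⟩ := (Metric.isBounded_range_of_tendsto _ (tendsto_qPoch q hq)).exists_norm_le
  exact ⟨C, fun n => hC _ ⟨n, rfl⟩⟩

theorem exists_norm_inv_qPoch_self_le {q : ℂ} (hq : ‖q‖ < 1) :
    ∃ C, ∀ n, ‖(qPoch q q n)⁻¹‖ ≤ C := by
  obtain ⟨C, hC⟩ := (Metric.isBounded_range_of_tendsto _
    ((tendsto_qPoch q hq).inv₀ (qPochInf_self_ne_zero hq))).exists_norm_le
  exact ⟨C, fun n => hC _ ⟨n, rfl⟩⟩

end Pochhammer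

/-! ### Gaussian polynomials and the q-binomial theorem. -/

section Gauss

theorem gauss_of_lt {q : ℂ} {N M : ℤ} (h : N < M) : gauss q N M = 0 :=
  if_neg (by omega)

theorem gauss_of_neg {q : ℂ} {N M : ℤ} (h : M < 0) : gauss q N M = 0 :=
  if_neg (by omega)

theorem gauss_nat_add (q : ℂ) (k e : ℕ) :
    gauss q (k + e : ℕ) k = qPoch q q (k + e) / (qPoch q q k * qPoch q q e) := by
  rw [gauss, if_pos (by omega)]
  congr 3
  omega

theorem gauss_zero_right {q : ℂ} (hq : ‖q‖ < 1) {N : ℤ} (h : 0 ≤ N) : gauss q N 0 = 1 := by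
  lift N to ℕ using h
  have := gauss_nat_add q 0 N
  rw [Nat.zero_add, Nat.cast_zero] at this
  rw [this, qPoch_zero, one_mul, div_self (qPoch_self_ne_zero hq N)]

theorem gauss_self {q : ℂ} (hq : ‖q‖ < 1) (k : ℕ) : gauss q k k = 1 := by
  have := gauss_nat_add q k 0
  rw [Nat.add_zero] at this
  rw [this, qPoch_zero, mul_one, div_self (qPoch_self_ne_zero hq k)]

/-- The `q`-Pascal recurrence, weighted by a power of `q` so that it also holds outside the
triangle. -/
theorem gauss_succ_succ {q : ℂ} (hq : ‖q‖ < 1) (k e : ℕ) :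
    gauss q (k + e + 1 : ℕ) (k + 1 : ℕ) =
      gauss q (k + e : ℕ) (k + 1 : ℕ) + q ^ e * gauss q (k + e : ℕ) k := by
  rcases e with _ | e
  · rw [gauss_of_lt (N := (k + 0 : ℕ)) (by push_cast; omega)]
    simp [gauss_self hq]
    simpa using gauss_self hq (k + 1)
  · have h1 := gauss_nat_add q (k + 1) (e + 1)
    have h2 := gauss_nat_add q (k + 1) e
    have h3 := gauss_nat_add q k (e + 1)
    rw [show k + (e + 1) + 1 = k + 1 + (e + 1) by ring, h1, h3,
      show k + (e + 1) = k + 1 + e by ring, h2,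
      show k + 1 + (e + 1) = k + 1 + e + 1 by ring, qPoch_succ q q (k + 1 + e),
      qPoch_succ q q k, qPoch_succ q q e]
    have := qPoch_self_ne_zero hq k
    have := qPoch_self_ne_zero hq e
    have := one_sub_pow_succ_ne_zero hq k
    have := one_sub_pow_succ_ne_zero hq e
    field_simp
    ring

/-- Induction on the number of factors: the two q-Pascal terms are the contributions of `1` and `x
q^n` in the last factor. -/
theorem prod_one_add_mul_pow {q : ℂ} (hq : ‖q‖ < 1) (x : ℂ) (n : ℕ) :
    ∏ i ∈ range n, (1 + x * q ^ i) =
      ∑ k ∈ range (n + 1), q ^ k.choose 2 * gauss q n k * x ^ k := by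
  induction n with
  | zero => simpa using (gauss_self hq 0).symm
  | succ n ih =>
    have hstep : ∀ k ∈ range (n + 1),
        q ^ (k + 1).choose 2 * gauss q (n + 1 : ℕ) (k + 1 : ℕ) * x ^ (k + 1) =
          q ^ (k + 1).choose 2 * gauss q n (k + 1 : ℕ) * x ^ (k + 1) +
            x * q ^ n * (q ^ k.choose 2 * gauss q n k * x ^ k) := by
      intro k hk
      obtain ⟨e, rfl⟩ := Nat.exists_eq_add_of_le (Nat.lt_succ_iff.1 (mem_range.1 hk))
      rw [gauss_succ_succ hq, Nat.choose_succ_succ' k 1, Nat.choose_one_right]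
      ring
    have htop : gauss q n (n + 1 : ℕ) = 0 := gauss_of_lt (by push_cast; omega)
    have hext : ∑ k ∈ range (n + 1), q ^ k.choose 2 * gauss q n k * x ^ k =
        ∑ k ∈ range (n + 1), q ^ (k + 1).choose 2 * gauss q n (k + 1 : ℕ) * x ^ (k + 1) + 1 := by
      have h := sum_range_succ (fun k : ℕ => q ^ k.choose 2 * gauss q n k * x ^ k) (n + 1)
      rw [sum_range_succ', htop] at h
      simpa [gauss_zero_right hq] using h.symm
    rw [prod_range_succ, sum_range_succ', sum_congr rfl hstep, sum_add_distrib, ← mul_sum, ih]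
    simp only [Nat.cast_zero, gauss_zero_right hq (Int.natCast_nonneg _), Nat.choose_zero_succ]
    linear_combination hext

end Gauss

/-! ### The Jacobi triple product, as a limit of its finite form. -/

section JacobiTripleProduct

theorem natCast_choose_two_mul_two (k : ℕ) : (k.choose 2 : ℤ) * 2 = k * (k - 1) := by
  induction k with
  | zero => simp
  | succ k ih =>
    rw [Nat.choose_succ_succ' k 1, Nat.choose_one_right]
    push_cast
    linear_combination ih

/-- The general term `(-z)^j p^{j(j-1)/2}` of the theta series in the Jacobi triple product. -/
noncomputable def thetaTerm (z p : ℂ) (j : ℤ) : ℂ :=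
  (-z) ^ j * p ^ (j * (j - 1) / 2)

theorem thetaTerm_zero (z p : ℂ) : thetaTerm z p 0 = 1 := by simp [thetaTerm]

theorem thetaTerm_add_one {z p : ℂ} (hz : z ≠ 0) (hp : p ≠ 0) (j : ℤ) :
    thetaTerm z p (j + 1) = thetaTerm z p j * (-z * p ^ j) := by
  have h : (j + 1) * (j + 1 - 1) / 2 = j * (j - 1) / 2 + j := by
    rw [← Int.add_mul_ediv_right _ _ two_ne_zero]
    congr 1
    ring
  rw [thetaTerm, thetaTerm, h, zpow_add₀ hp, zpow_add_one₀ (neg_ne_zero.2 hz)]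
  ring

theorem thetaTerm_natCast_succ {z p : ℂ} (hz : z ≠ 0) (hp : p ≠ 0) (n : ℕ) :
    thetaTerm z p (n + 1 : ℕ) = thetaTerm z p n * (-z * p ^ n) := by
  rw [Nat.cast_succ, thetaTerm_add_one hz hp, zpow_natCast]

theorem thetaTerm_neg_succ {z p : ℂ} (hz : z ≠ 0) (hp : p ≠ 0) (n : ℕ) :
    thetaTerm z p (-(n + 1 : ℕ)) = thetaTerm z p (-n) * (-(p / z) * p ^ n) := by
  have h := thetaTerm_add_one hz hp (-(n + 1 : ℕ))
  rw [show -((n + 1 : ℕ) : ℤ) + 1 = -n by push_cast; ring, zpow_neg, zpow_natCast, pow_succ] at h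
  rw [h]
  field_simp

theorem summable_of_succ_eq_mul_pow {f : ℕ → ℂ} {w p : ℂ} (hp : ‖p‖ < 1)
    (h : ∀ n, f (n + 1) = f n * (w * p ^ n)) : Summable f := by
  have ht : Tendsto (fun n : ℕ => ‖w * p ^ n‖) atTop (𝓝 0) := by
    simpa using ((tendsto_pow_atTop_nhds_zero_of_norm_lt_one hp).const_mul w).norm
  refine summable_of_ratio_norm_eventually_le (r := 1 / 2) (by norm_num) ?_
  filter_upwards [ht.eventually_le_const (show (0 : ℝ) < 1 / 2 by norm_num)] with n hn
  rw [h, norm_mul, mul_comm]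
  gcongr

theorem summable_thetaTerm {z p : ℂ} (hz : z ≠ 0) (hp : p ≠ 0) (hp1 : ‖p‖ < 1) :
    Summable (thetaTerm z p) :=
  Summable.of_nat_of_neg
    (summable_of_succ_eq_mul_pow hp1 (thetaTerm_natCast_succ hz hp))
    (summable_of_succ_eq_mul_pow hp1 (thetaTerm_neg_succ hz hp))

theorem prod_range_neg_div_pow (z p : ℂ) (N : ℕ) :
    ∏ i ∈ range N, (-z / p ^ (i + 1)) = (-z) ^ N / p ^ (N + 1).choose 2 := by
  induction N with
  | zero => simp
  | succ N ih =>
    rw [prod_range_succ, ih, Nat.choose_succ_succ' (N + 1) 1, Nat.choose_one_right]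
    ring

/-- The finite form of the Jacobi triple product identity. -/
theorem qPoch_mul_qPoch_div {z p : ℂ} (hz : z ≠ 0) (hp : p ≠ 0) (hp1 : ‖p‖ < 1) (N : ℕ) :
    qPoch z p N * qPoch (p / z) p N =
      ∑ k ∈ range (2 * N + 1), thetaTerm z p (k - N) * gauss p (2 * N : ℕ) k := by
  have hlow : ∏ i ∈ range N, (1 + -z / p ^ N * p ^ i) =
      (-z) ^ N / p ^ (N + 1).choose 2 * qPoch (p / z) p N := by
    rw [← prod_range_reflect, ← prod_range_neg_div_pow, qPoch, ← prod_mul_distrib]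
    refine prod_congr rfl fun i hi => ?_
    obtain ⟨e, rfl⟩ := Nat.exists_eq_add_of_lt (mem_range.1 hi)
    rw [show i + e + 1 - 1 - i = e by omega, show i + e + 1 = i + 1 + e by ring, pow_add p (i + 1)]
    field_simp
    ring
  have hhigh : ∏ i ∈ range N, (1 + -z / p ^ N * p ^ (N + i)) = qPoch z p N := by
    refine prod_congr rfl fun i _ => ?_
    rw [pow_add]
    field_simp
    ring
  have hc : (-z) ^ N / p ^ (N + 1).choose 2 ≠ 0 :=
    div_ne_zero (pow_ne_zero _ (neg_ne_zero.2 hz)) (pow_ne_zero _ hp)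
  -- With `x = -z / p^N` and `2N` factors, the upper half is `(z; p)_N`; the lower half, reversed,
  -- is `(p/z; p)_N` times a monomial.
  have key := prod_one_add_mul_pow hp1 (-z / p ^ N) (2 * N)
  rw [two_mul, prod_range_add, hlow, hhigh, ← two_mul] at key
  refine mul_left_cancel₀ hc ?_
  rw [mul_sum, ← mul_assoc, mul_right_comm, key]
  refine sum_congr rfl fun k _ => ?_
  have hexp : ((k : ℤ) - N) * (k - N - 1) / 2 =
      (k.choose 2 : ℕ) + ((N + 1).choose 2 : ℕ) - (N * k : ℕ) := by
    refine Int.ediv_eq_of_eq_mul_left two_ne_zero ?_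
    have h1 := natCast_choose_two_mul_two k
    have h2 := natCast_choose_two_mul_two (N + 1)
    push_cast at h1 h2 ⊢
    linear_combination -h1 - h2
  rw [thetaTerm, hexp, zpow_sub₀ hp, zpow_add₀ hp, zpow_sub₀ (neg_ne_zero.2 hz)]
  simp only [zpow_natCast]
  rw [div_pow, ← pow_mul]
  have := pow_ne_zero N (neg_ne_zero.2 hz)
  field_simp

/-- Uniformity in both indices supplies the dominating function for the limit in the triple product.
-/
theorem exists_norm_gauss_le {p : ℂ} (hp1 : ‖p‖ < 1) : ∃ C, ∀ N M : ℤ, ‖gauss p N M‖ ≤ C := by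
  obtain ⟨C, hC⟩ := exists_norm_qPoch_self_le hp1
  obtain ⟨C', hC'⟩ := exists_norm_inv_qPoch_self_le hp1
  have h0 : 0 ≤ C := (norm_nonneg _).trans (hC 0)
  have h0' : 0 ≤ C' := (norm_nonneg _).trans (hC' 0)
  refine ⟨C * (C' * C'), fun N M => ?_⟩
  rw [gauss]
  split_ifs
  · rw [div_eq_mul_inv, mul_inv, norm_mul, norm_mul]
    gcongr <;> apply_assumption
  · simpa using by positivity

theorem tendsto_gauss {p : ℂ} (hp1 : ‖p‖ < 1) (j : ℤ) :
    Tendsto (fun N : ℕ => gauss p (2 * N : ℕ) (N + j)) atTop (𝓝 (qPochInf p p)⁻¹) := by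
  have h0 := qPochInf_self_ne_zero hp1
  have hT := tendsto_qPoch p hp1
  have h1 : Tendsto (fun N : ℕ => 2 * N) atTop atTop :=
    tendsto_atTop.2 fun b => by
      filter_upwards [eventually_ge_atTop b] with N hN
      omega
  have h2 : ∀ i : ℤ, Tendsto (fun N : ℕ => (N + i).toNat) atTop atTop := fun i =>
    tendsto_atTop.2 fun b => by
      filter_upwards [eventually_ge_atTop (b + i.natAbs)] with N hN
      omega
  have h3 := (hT.comp h1).div ((hT.comp (h2 j)).mul (hT.comp (h2 (-j)))) (mul_ne_zero h0 h0)
  rw [div_mul_cancel_left₀ h0] at h3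
  refine h3.congr' ?_
  filter_upwards [eventually_ge_atTop j.natAbs] with N hN
  rw [gauss, if_pos (by omega)]
  simp only [Function.comp, Pi.div_apply, Int.toNat_natCast]
  congr 3
  omega

/-- The Jacobi triple product identity. -/
theorem hasSum_thetaTerm {z p : ℂ} (hz : z ≠ 0) (hp : p ≠ 0) (hp1 : ‖p‖ < 1) :
    HasSum (thetaTerm z p) (qPochInf z p * qPochInf (p / z) p * qPochInf p p) := by
  obtain ⟨C, hC⟩ := exists_norm_gauss_le hp1
  have hs := summable_thetaTerm hz hp hp1
  have hlim : Tendsto (fun N : ℕ => ∑' j, thetaTerm z p j * gauss p (2 * N : ℕ) (N + j)) atTop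
      (𝓝 (∑' j, thetaTerm z p j * (qPochInf p p)⁻¹)) := by
    refine tendsto_tsum_of_dominated_convergence (hs.norm.mul_right C)
      (fun j => (tendsto_gauss hp1 j).const_mul _) (Eventually.of_forall fun N j => ?_)
    rw [norm_mul]
    gcongr
    exact hC _ _
  have hfin : ∀ N : ℕ, ∑' j, thetaTerm z p j * gauss p (2 * N : ℕ) (N + j) =
      qPoch z p N * qPoch (p / z) p N := by
    intro N
    -- The Gaussian polynomial vanishes unless `-N ≤ j ≤ N`; then reindex by `k = j + N`.
    rw [qPoch_mul_qPoch_div hz hp hp1, tsum_eq_sum (s := Icc (-N : ℤ) N)]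
    · refine sum_nbij' (fun j => (j + N).toNat) (fun k => k - N) ?_ ?_ ?_ ?_ ?_
      · intro j hj
        simp only [mem_Icc, mem_range] at *
        omega
      · intro k hk
        simp only [mem_Icc, mem_range] at *
        omega
      · intro j hj
        simp only [mem_Icc] at *
        omega
      · intro k hk
        simp only [mem_range] at *
        omega
      · intro j hj
        simp only [mem_Icc] at hj
        rw [Int.toNat_of_nonneg (by omega)]
        congr 2 <;> ring
    · intro j hj
      rw [mem_Icc, not_and_or] at hj
      rcases hj with hj | hj
      · rw [gauss_of_neg (by omega), mul_zero]
      · rw [gauss_of_lt (by push_cast; omega), mul_zero]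
  simp only [hfin] at hlim
  have h := tendsto_nhds_unique hlim ((tendsto_qPoch z hp1).mul (tendsto_qPoch (p / z) hp1))
  rw [tsum_mul_right, ← div_eq_mul_inv, div_eq_iff (qPochInf_self_ne_zero hp1)] at h
  rw [← h]
  exact hs.hasSum

end JacobiTripleProduct

/-! ### Recurrence for the Schur polynomials. -/

section Schur

/-- The Schur polynomials: `schur 0 m` is `b_m`, and `schur 1 m` is `a_m` for `m ≥ 1`. -/
noncomputable def schur (c m : ℕ) (q : ℂ) : ℂ :=
  ∑ n ∈ range m, q ^ (n ^ 2 + c * n) * gauss q ((m : ℤ) - 1 - c - n) n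

/-- q-Pascal applied to each term, with `n` shifted by one. The bound `c ≤ m` makes both `n = 0`
terms equal to `1`. -/
theorem schur_add_two {q : ℂ} (hq : ‖q‖ < 1) {c m : ℕ} (hc : c ≤ m) :
    schur c (m + 2) q = schur c (m + 1) q + q ^ m * schur c m q := by
  set F : ℕ → ℕ → ℂ := fun m n => q ^ (n ^ 2 + c * n) * gauss q ((m : ℤ) - 1 - c - n) n with hF
  have hvanish : ∀ m, F m m = 0 := fun m => by
    simp only [hF]
    rw [gauss_of_lt (by omega), mul_zero]
  have hone : ∀ n, c < n → F n 0 = 1 := fun n hn => by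
    have : gauss q ((n : ℤ) - 1 - c) 0 = 1 := gauss_zero_right hq (by omega)
    simp [hF, this]
  have hstep : ∀ n, F (m + 2) (n + 1) = F (m + 1) (n + 1) + q ^ m * F m n := by
    intro n
    simp only [hF]
    by_cases h : (m : ℤ) - 1 - c - n < n
    · rw [gauss_of_lt (by push_cast; omega), gauss_of_lt (by push_cast; omega), gauss_of_lt h]
      simp
    · obtain ⟨e, rfl⟩ : ∃ e, m = 1 + c + 2 * n + e := ⟨m - (1 + c + 2 * n), by omega⟩
      rw [show ((1 + c + 2 * n + e + 2 : ℕ) : ℤ) - 1 - c - (n + 1 : ℕ) = (n + e + 1 : ℕ) by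
          push_cast; ring,
        show ((1 + c + 2 * n + e + 1 : ℕ) : ℤ) - 1 - c - (n + 1 : ℕ) = (n + e : ℕ) by
          push_cast; ring,
        show ((1 + c + 2 * n + e : ℕ) : ℤ) - 1 - c - n = (n + e : ℕ) by push_cast; ring,
        gauss_succ_succ hq]
      ring
  have h2 : schur c (m + 2) q = ∑ n ∈ range (m + 1), F (m + 2) (n + 1) + F (m + 2) 0 :=
    sum_range_succ' (F (m + 2)) (m + 1)
  have h1 : schur c (m + 1) q = ∑ n ∈ range (m + 1), F (m + 1) (n + 1) + F (m + 1) 0 := by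
    rw [← sum_range_succ', sum_range_succ, hvanish, add_zero]
    rfl
  have h0 : schur c m q = ∑ n ∈ range (m + 1), F m n := by
    rw [sum_range_succ, hvanish, add_zero]
    rfl
  rw [h2, h1, h0, mul_sum, sum_congr rfl fun n _ => hstep n, sum_add_distrib,
    hone _ (by omega), hone _ (by omega)]
  ring

theorem b_eq_schur (m : ℕ) (q : ℂ) : b m q = schur 0 m q := by
  rcases m with _ | m <;> simp [b, schur]

theorem a_succ_eq_schur (m : ℕ) (q : ℂ) : a (m + 1) q = schur 1 (m + 1) q := by
  rw [a, if_neg m.succ_ne_zero, schur]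
  refine sum_congr rfl fun n _ => ?_
  rw [one_mul]
  congr 2
  push_cast
  ring

theorem b_one {q : ℂ} (hq : ‖q‖ < 1) : b 1 q = 1 := by
  simp [b, gauss_zero_right hq]

theorem a_one (q : ℂ) : a 1 q = 0 := by
  simp [a, gauss_of_lt]

theorem a_two {q : ℂ} (hq : ‖q‖ < 1) : a 2 q = 1 := by
  simp [a, sum_range_succ, gauss_zero_right hq, gauss_of_lt]

theorem b_add_two {q : ℂ} (hq : ‖q‖ < 1) (m : ℕ) :
    b (m + 2) q = b (m + 1) q + q ^ m * b m q := by
  simp only [b_eq_schur, schur_add_two hq m.zero_le]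

theorem a_add_two {q : ℂ} (hq : ‖q‖ < 1) (m : ℕ) :
    a (m + 2) q = a (m + 1) q + q ^ m * a m q := by
  -- The value `a_0 = 1` is not the empty sum `schur 1 0`, so `m = 0` is checked directly.
  rcases m with _ | m
  · rw [Nat.zero_add, Nat.zero_add, a_one, a_two hq]
    simp [a]
  · simp only [a_succ_eq_schur, schur_add_two hq m.succ_pos]

end Schur

/-! ### The three-term recurrence of the series in `m`. -/

section Telescoping

theorem pentagonal_exponent_succ (n : ℕ) :
    (n + 1) * (5 * (n + 1) - 1) / 2 = n * (5 * n - 1) / 2 + (5 * n + 2) := by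
  rw [← Nat.add_mul_div_right _ _ two_pos]
  congr 1
  rcases n with _ | n
  · rfl
  · rw [show 5 * (n + 1 + 1) - 1 = 5 * n + 9 by omega, show 5 * (n + 1) - 1 = 5 * n + 4 by omega]
    ring

theorem le_pentagonal_exponent (n : ℕ) : n ≤ n * (5 * n - 1) / 2 := by
  induction n with
  | zero => simp
  | succ n ih => rw [pentagonal_exponent_succ]; omega

/-- The general term of the series with parameter `m`. -/
noncomputable def seriesTerm (m : ℕ) (q : ℂ) (n : ℕ) : ℂ :=
  wpFactor m n q * q ^ (n * (5 * n - 1) / 2 + 2 * m * n) * (-1) ^ n / qPoch q q n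

/-- The partial sums of `seriesTerm m - seriesTerm (m + 1) - q ^ (m + 1) * seriesTerm (m + 2)`. -/
noncomputable def telescoped (m : ℕ) (q : ℂ) (n : ℕ) : ℂ :=
  (-1) ^ n * q ^ (n * (5 * n - 1) / 2 + 2 * m * n + (5 * n + 2 + 2 * m)) *
    (1 + q ^ (n + 1) - q ^ (m + 2 * n + 2)) * qPoch q q (n + m) * (qPoch q q n)⁻¹

theorem summable_telescoped (m : ℕ) {q : ℂ} (hq : ‖q‖ < 1) : Summable (telescoped m q) := by
  obtain ⟨C, hC⟩ := exists_norm_qPoch_self_le hq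
  obtain ⟨C', hC'⟩ := exists_norm_inv_qPoch_self_le hq
  have h0 : 0 ≤ C := (norm_nonneg _).trans (hC 0)
  refine Summable.of_norm_bounded (g := fun n : ℕ => ‖q‖ ^ n * 3 * C * C') ?_ fun n => ?_
  · exact (((summable_geometric_of_lt_one (norm_nonneg q) hq).mul_right _).mul_right _).mul_right _
  · have hp : ∀ k, ‖q ^ k‖ ≤ 1 := fun k => by
      rw [norm_pow]
      exact pow_le_one₀ (norm_nonneg q) hq.le
    have h1 : ‖1 + q ^ (n + 1) - q ^ (m + 2 * n + 2)‖ ≤ 3 := by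
      refine (norm_sub_le _ _).trans ?_
      have := norm_add_le (1 : ℂ) (q ^ (n + 1))
      rw [norm_one] at this
      linarith [hp (n + 1), hp (m + 2 * n + 2)]
    have h2 : ‖(-1 : ℂ) ^ n * q ^ (n * (5 * n - 1) / 2 + 2 * m * n + (5 * n + 2 + 2 * m))‖ ≤
        ‖q‖ ^ n := by
      rw [norm_mul, norm_pow, norm_neg, norm_one, one_pow, one_mul, norm_pow]
      refine pow_le_pow_of_le_one (norm_nonneg q) hq.le ?_
      have := le_pentagonal_exponent n
      omega
    rw [telescoped, norm_mul, norm_mul, norm_mul]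
    gcongr
    · exact hC _
    · exact hC' _

theorem seriesTerm_recurrence_zero (m : ℕ) (q : ℂ) :
    seriesTerm m q 0 - seriesTerm (m + 1) q 0 - q ^ (m + 1) * seriesTerm (m + 2) q 0 =
      telescoped m q 0 := by
  have h : ∀ k, seriesTerm k q 0 = qPoch q q k := by
    intro k
    rcases k with _ | k
    · simp [seriesTerm, wpFactor, qPoch_zero]
    · simp [seriesTerm, wpFactor, qPoch_zero, qPoch_succ]
      ring
  simp only [h, qPoch_succ, telescoped, qPoch_zero, Nat.zero_add, zero_mul, Nat.zero_div]
  ring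

theorem seriesTerm_recurrence_succ (m : ℕ) {q : ℂ} (hq : ‖q‖ < 1) (n : ℕ) :
    seriesTerm m q (n + 1) - seriesTerm (m + 1) q (n + 1) -
        q ^ (m + 1) * seriesTerm (m + 2) q (n + 1) =
      telescoped m q (n + 1) - telescoped m q n := by
  have hQ := qPoch_self_ne_zero hq n
  have hX := one_sub_pow_succ_ne_zero hq n
  simp only [seriesTerm, telescoped, wpFactor]
  rw [if_neg (by omega), if_neg (by omega), if_neg (by omega),
    show n + 1 + m - 1 = n + m by omega, show n + 1 + (m + 1) - 1 = n + m + 1 by omega,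
    show n + 1 + (m + 2) - 1 = n + m + 1 + 1 by omega, show n + 1 + m = n + m + 1 by omega]
  simp only [pentagonal_exponent_succ, qPoch_succ]
  -- Only the increment of the quadratic exponent matters, so a polynomial identity remains.
  generalize n * (5 * n - 1) / 2 = e
  field_simp
  ring

/-- The sum is `T_0 + ∑ (T_{n+1} - T_n)` with `T = telescoped m q` summable, hence `0`. -/
theorem hasSum_seriesTerm_recurrence (m : ℕ) {q : ℂ} (hq : ‖q‖ < 1) :
    HasSum (fun n => seriesTerm m q n - seriesTerm (m + 1) q n -
      q ^ (m + 1) * seriesTerm (m + 2) q n) 0 := by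
  have hs := (summable_telescoped m hq).hasSum
  rw [← hasSum_nat_add_iff' 1]
  simp only [seriesTerm_recurrence_succ m hq, sum_range_one, seriesTerm_recurrence_zero]
  have := ((hasSum_nat_add_iff' 1).2 hs).sub hs
  simpa using this

end Telescoping

/-! ### The cases `m = 0` and `m = 1` as theta series in base `q^5`. -/

section InitialValues

theorem thetaTerm_sq_natCast {q : ℂ} (hq0 : q ≠ 0) (n : ℕ) :
    thetaTerm (q ^ 2) (q ^ 5) n = (-1) ^ n * q ^ (n * (5 * n - 1) / 2) := by
  induction n with
  | zero => simp [thetaTerm_zero]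
  | succ n ih =>
    rw [thetaTerm_natCast_succ (pow_ne_zero _ hq0) (pow_ne_zero _ hq0), ih,
      pentagonal_exponent_succ]
    ring

theorem thetaTerm_sq_neg_natCast {q : ℂ} (hq0 : q ≠ 0) (n : ℕ) :
    thetaTerm (q ^ 2) (q ^ 5) (-n) = (-1) ^ n * q ^ (n * (5 * n - 1) / 2 + n) := by
  induction n with
  | zero => simp [thetaTerm_zero]
  | succ n ih =>
    rw [thetaTerm_neg_succ (pow_ne_zero _ hq0) (pow_ne_zero _ hq0), ih,
      pentagonal_exponent_succ, show q ^ 5 / q ^ 2 = q ^ 3 by field_simp]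
    ring

theorem thetaTerm_pow_four_natCast {q : ℂ} (hq0 : q ≠ 0) (n : ℕ) :
    thetaTerm (q ^ 4) (q ^ 5) n = (-1) ^ n * q ^ (n * (5 * n - 1) / 2 + 2 * n) := by
  induction n with
  | zero => simp [thetaTerm_zero]
  | succ n ih =>
    rw [thetaTerm_natCast_succ (pow_ne_zero _ hq0) (pow_ne_zero _ hq0), ih,
      pentagonal_exponent_succ]
    ring

theorem thetaTerm_pow_four_neg_succ {q : ℂ} (hq0 : q ≠ 0) (n : ℕ) :
    thetaTerm (q ^ 4) (q ^ 5) (-(n + 1 : ℕ)) =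
      -((-1) ^ n * q ^ (n * (5 * n - 1) / 2 + 4 * n + 1)) := by
  have hd : q ^ 5 / q ^ 4 = q := by field_simp
  induction n with
  | zero =>
    rw [thetaTerm_neg_succ (pow_ne_zero _ hq0) (pow_ne_zero _ hq0), hd]
    simp [thetaTerm_zero]
  | succ n ih =>
    rw [thetaTerm_neg_succ (pow_ne_zero _ hq0) (pow_ne_zero _ hq0), ih,
      pentagonal_exponent_succ, hd]
    ring

theorem seriesTerm_zero_succ {q : ℂ} (hq : ‖q‖ < 1) (n : ℕ) :
    seriesTerm 0 q (n + 1) =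
      (1 + q ^ (n + 1)) * (-1) ^ (n + 1) * q ^ ((n + 1) * (5 * (n + 1) - 1) / 2) := by
  have hQ := qPoch_self_ne_zero hq n
  have hX := one_sub_pow_succ_ne_zero hq n
  rw [seriesTerm, wpFactor, if_neg (by omega), qPoch_succ]
  simp only [add_zero, Nat.add_sub_cancel, mul_zero, zero_mul]
  generalize (n + 1) * (5 * (n + 1) - 1) / 2 = e
  field_simp
  ring

theorem seriesTerm_one {q : ℂ} (hq : ‖q‖ < 1) (n : ℕ) :
    seriesTerm 1 q n =
      (1 - q ^ (2 * n + 1)) * (-1) ^ n * q ^ (n * (5 * n - 1) / 2 + 2 * n) := by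
  have hQ := qPoch_self_ne_zero hq n
  rw [seriesTerm, wpFactor, if_neg (by omega), Nat.add_sub_cancel, mul_one]
  field_simp

theorem norm_pow_five_lt_one {q : ℂ} (hq : ‖q‖ < 1) : ‖q ^ 5‖ < 1 := by
  rw [norm_pow]
  exact pow_lt_one₀ (norm_nonneg q) hq (by norm_num)

theorem qPochInf_zero_left (q : ℂ) : qPochInf 0 q = 1 := by simp [qPochInf]

theorem hasSum_seriesTerm_at_zero (m : ℕ) : HasSum (seriesTerm m 0) 1 := by
  have h : seriesTerm m 0 0 = 1 := by
    rcases m with _ | m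
    · simp [seriesTerm, wpFactor, qPoch_zero]
    · simp [seriesTerm, wpFactor, qPoch]
  rw [← h]
  refine hasSum_single 0 fun n hn => ?_
  have := le_pentagonal_exponent n
  rw [seriesTerm, zero_pow (by omega), mul_zero, zero_mul, zero_div]

theorem hasSum_seriesTerm_zero {q : ℂ} (hq : ‖q‖ < 1) :
    HasSum (seriesTerm 0 q)
      (qPochInf (q ^ 2) (q ^ 5) * qPochInf (q ^ 3) (q ^ 5) * qPochInf (q ^ 5) (q ^ 5)) := by
  rcases eq_or_ne q 0 with rfl | hq0
  · simpa [qPochInf_zero_left] using hasSum_seriesTerm_at_zero 0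
  · have h := hasSum_thetaTerm (pow_ne_zero 2 hq0) (pow_ne_zero 5 hq0) (norm_pow_five_lt_one hq)
    rw [show q ^ 5 / q ^ 2 = q ^ 3 by field_simp] at h
    -- Pairing `j = n` with `j = -n` counts `j = 0` twice; the extra `1` is removed.
    have h' := h.nat_add_neg.sub (hasSum_ite_eq (0 : ℕ) (1 : ℂ))
    rw [thetaTerm_zero, add_sub_cancel_right] at h'
    refine h'.congr_fun fun n => ?_
    rw [thetaTerm_sq_natCast hq0, thetaTerm_sq_neg_natCast hq0]
    rcases n with _ | n
    · simp [seriesTerm, wpFactor, qPoch_zero]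
    · rw [seriesTerm_zero_succ hq, if_neg n.succ_ne_zero]
      ring

theorem hasSum_seriesTerm_one {q : ℂ} (hq : ‖q‖ < 1) :
    HasSum (seriesTerm 1 q)
      (qPochInf q (q ^ 5) * qPochInf (q ^ 4) (q ^ 5) * qPochInf (q ^ 5) (q ^ 5)) := by
  rcases eq_or_ne q 0 with rfl | hq0
  · simpa [qPochInf_zero_left] using hasSum_seriesTerm_at_zero 1
  · have h := hasSum_thetaTerm (pow_ne_zero 4 hq0) (pow_ne_zero 5 hq0) (norm_pow_five_lt_one hq)
    rw [show q ^ 5 / q ^ 4 = q by field_simp, mul_comm (qPochInf (q ^ 4) _)] at h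
    -- Here `j = n` is paired with `j = -(n + 1)`, so no index repeats.
    refine h.nat_add_neg_add_one.congr_fun fun n => ?_
    rw [← Nat.cast_succ, thetaTerm_pow_four_natCast hq0, thetaTerm_pow_four_neg_succ hq0,
      seriesTerm_one hq]
    ring

end InitialValues

/-- Two-step induction; solving the recurrence for `S_{m+2}` divides by `q^{m+1}`, whence `q ≠ 0`.
-/
theorem hasSum_seriesTerm_of_ne_zero {q A B : ℂ} (hq : ‖q‖ < 1) (hq0 : q ≠ 0)
    (h0 : HasSum (seriesTerm 0 q) A) (h1 : HasSum (seriesTerm 1 q) B) (m : ℕ) :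
    HasSum (seriesTerm m q) ((b m q * B - a m q * A) / (-(-1) ^ m * q ^ m.choose 2)) := by
  induction m using Nat.twoStepInduction with
  | zero => simpa [a, b] using h0
  | one => simpa [a_one, b_one hq] using h1
  | more m ih0 ih1 =>
    have h := ((ih0.sub ih1).sub (hasSum_seriesTerm_recurrence m hq)).div_const (q ^ (m + 1))
    have hterm : ∀ n, (seriesTerm m q n - seriesTerm (m + 1) q n -
        (seriesTerm m q n - seriesTerm (m + 1) q n - q ^ (m + 1) * seriesTerm (m + 2) q n)) /
          q ^ (m + 1) = seriesTerm (m + 2) q n := fun n => by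
      rw [sub_sub_cancel, mul_div_cancel_left₀ _ (pow_ne_zero _ hq0)]
    have hsum : ((b m q * B - a m q * A) / (-(-1) ^ m * q ^ m.choose 2) -
        (b (m + 1) q * B - a (m + 1) q * A) / (-(-1) ^ (m + 1) * q ^ (m + 1).choose 2) - 0) /
          q ^ (m + 1) =
        (b (m + 2) q * B - a (m + 2) q * A) / (-(-1) ^ (m + 2) * q ^ (m + 2).choose 2) := by
      rw [a_add_two hq, b_add_two hq, Nat.choose_succ_succ' (m + 1) 1, Nat.choose_succ_succ' m 1,
        Nat.choose_one_right, Nat.choose_one_right]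
      field_simp
      ring
    simp only [hterm, hsum] at h
    exact h

end MVersion

theorem corollary2p8 (m : ℕ) (q : ℂ) (hq : ‖q‖ < 1) (hq0 : 2 ≤ m → q ≠ 0) :
    HasSum
      (fun n : ℕ =>
        MVersion.wpFactor m n q * q ^ (n * (5 * n - 1) / 2 + 2 * m * n) * (-1) ^ n /
          MVersion.qPoch q q n)
      ((MVersion.b m q *
            (MVersion.qPochInf q (q ^ 5) * MVersion.qPochInf (q ^ 4) (q ^ 5) *
              MVersion.qPochInf (q ^ 5) (q ^ 5)) -
          MVersion.a m q *
            (MVersion.qPochInf (q ^ 2) (q ^ 5) * MVersion.qPochInf (q ^ 3) (q ^ 5) *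
              MVersion.qPochInf (q ^ 5) (q ^ 5))) /
        ((-1) ^ ((m : ℤ) - 1) * q ^ (m * (m - 1) / 2))) := by
  have h0 := MVersion.hasSum_seriesTerm_zero hq
  have h1 := MVersion.hasSum_seriesTerm_one hq
  have hsign : (-1 : ℂ) ^ ((m : ℤ) - 1) = -(-1) ^ m := by
    rw [zpow_sub_one₀ (by norm_num), zpow_natCast]
    norm_num
  rw [hsign, ← Nat.choose_two_right]
  change HasSum (MVersion.seriesTerm m q) _
  -- For `m < 2` the value `q = 0` is allowed, so the initial values are used directly.
  rcases Nat.lt_or_ge m 2 with hm | hm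
  · interval_cases m
    · simpa [MVersion.a, MVersion.b] using h0
    · simpa [MVersion.a_one, MVersion.b_one hq] using h1
  · exact MVersion.hasSum_seriesTerm_of_ne_zero hq (hq0 hm) h0 h1 m
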